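/- Let $\theta>0$, $\sigma\in\mathbb{R}$, let $A<B$ be real numbers, and let $W$ be a two-sided Brownian motion on a probability space. Let $u$ be the mild solution on the whole line of the stochastic heat equation with space-only white noise $$\partial_t u(t,x)=\theta\,\partial_x^2u(t,x)+\sigma\,\dot W(x),\quad t>0,\ x\in\mathbb{R},\qquad u(0,\cdot)=0,$$ that is, for all $t\ge 0$ and $x\in\mathbb{R}$, almost surely $$u(t,x)=\sigma\int_0^t\int_{\mathbb{R}}P(t-s,x-y)\,dW(y)\,ds,\qquad P(t,x)=(4\pi\theta t)^{-1/2}e^{-x^2/(4\theta t)},$$ where the inner integral is a Wiener integral and the outer one is an integral of an $L^2(\Omega)$-valued function, and where $u$ is taken in a version such that, for every $t>0$, the paths $x\mapsto u(t,x)$ are almost surely continuous. Then for every $t>0$ the function $u(t,\cdot)$ is almost surely differentiable on $\mathbb{R}$, its derivative $u_x(t,x)$ is square integrable for every $x\in\mathbb{R}$, and for every $x\in\mathbb{R}$ and every real $\alpha<1$, $$\lim_{N\to\infty}N^{\alpha}\left[N\,\mathbb{E}\left|u_x\left(t,x+\frac{B-A}{N}\right)-u_x(t,x)\right|^2-\frac{\sigma^2(B-A)}{\theta^2}\right]=0.$$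 In particular, $$\lim_{N\to\infty}N\,\mathbb{E}\left|u_x\left(t,x+\frac{B-A}{N}\right)-u_x(t,x)\right|^2=\frac{\sigma^2(B-A)}{\theta^2}.$$ -/

import Mathlib

open MeasureTheory ProbabilityTheory Filter Topology

noncomputable section

/-- `W` is a two-sided Brownian motion on `(Ω, P)`: a centered Gaussian process indexed by `ℝ` with
covariance `(|x| + |y| - |x - y|) / 2` (that is, `min |x| |y|` if `x`, `y` have the same sign and
`0` otherwise) and almost surely continuous paths. -/
structure IsTwoSidedBrownian {Ω : Type*} [MeasurableSpace Ω] (W : ℝ → Ω → ℝ) (P : Measure Ω) :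
    Prop where
  isGaussianProcess : IsGaussianProcess W P
  mean_zero : ∀ x, ∫ ω, W x ω ∂P = 0
  covariance_eq : ∀ x y, cov[W x, W y; P] = (|x| + |y| - |x - y|) / 2
  continuous_paths : ∀ᵐ ω ∂P, Continuous fun x => W x ω

/-- A finite collection of coefficients `c i` and intervals `(a i, b i]`, representing the step
function `∑ i, c i * 1_{(a i, b i]}` on `ℝ`. -/
structure StepData where
  n : ℕ
  c : Fin n → ℝ
  a : Fin n → ℝ
  b : Fin n → ℝ
  a_le_b : ∀ i, a i ≤ b i

/-- The step function `∑ i, c i * 1_{(a i, b i]}`. -/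
def StepData.toFun (φ : StepData) (y : ℝ) : ℝ :=
  ∑ i, φ.c i * (Set.Ioc (φ.a i) (φ.b i)).indicator (fun _ => (1 : ℝ)) y

/-- The elementary integral `∑ i, c i * (W (b i) - W (a i))` of a step function. -/
def StepData.integral {Ω : Type*} (φ : StepData) (W : ℝ → Ω → ℝ) (ω : Ω) : ℝ :=
  ∑ i, φ.c i * (W (φ.b i) ω - W (φ.a i) ω)

/-- `X` is the Wiener integral `∫ f dW`: there are step functions converging to `f` in `L²(ℝ)` whose
elementary integrals converge to `X` in `L²(P)`. -/
def HasWienerIntegral {Ω : Type*} [MeasurableSpace Ω] (W : ℝ → Ω → ℝ) (P : Measure Ω)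
    (f : ℝ → ℝ) (X : Lp ℝ 2 P) : Prop :=
  ∃ φ : ℕ → StepData,
    Tendsto (fun k => eLpNorm (fun y => (φ k).toFun y - f y) 2 volume) atTop (𝓝 0) ∧
    Tendsto (fun k => eLpNorm (fun ω => (φ k).integral W ω - X ω) 2 P) atTop (𝓝 0)

open Classical in
/-- The Wiener integral `∫ f(y) dW(y)` as an element of `L²(P)`. For a two-sided Brownian motion
`W` and `f ∈ L²(ℝ)` it exists and is unique; the value `0` is only used outside of that case. -/
def wienerIntegral {Ω : Type*} [MeasurableSpace Ω] (W : ℝ → Ω → ℝ) (P : Measure Ω)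
    (f : ℝ → ℝ) : Lp ℝ 2 P :=
  if h : ∃ X, HasWienerIntegral W P f X then h.choose else 0

/-- The heat kernel `(4πθt)^{-1/2} exp(-x² / (4θt))` of `∂_t - θ ∂_x²` on `ℝ`. -/
def heatKernel (θ t x : ℝ) : ℝ :=
  (Real.sqrt (4 * Real.pi * θ * t))⁻¹ * Real.exp (-x ^ 2 / (4 * θ * t))

/-- The random variable `σ ∫₀ᵗ ∫_ℝ P(t - s, x - y) dW(y) ds`, where the outer integral is the
Lebesgue (Bochner) integral of the `L²(P)`-valued function given by the inner Wiener integral. -/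
def mildField {Ω : Type*} [MeasurableSpace Ω] (σ θ : ℝ) (W : ℝ → Ω → ℝ) (P : Measure Ω)
    (t x : ℝ) : Lp ℝ 2 P :=
  σ • ∫ s in (0 : ℝ)..t, wienerIntegral W P (fun y => heatKernel θ (t - s) (x - y))

/-- The random field `u` is (a version of) the mild solution on `ℝ` of
`∂_t u = θ ∂_x² u + σ dW/dx`, `u(0, ·) = 0`. -/
def IsMildSolution {Ω : Type*} [MeasurableSpace Ω] (σ θ : ℝ) (W : ℝ → Ω → ℝ) (P : Measure Ω)
    (u : ℝ → ℝ → Ω → ℝ) : Prop :=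
  ∀ t, 0 ≤ t → ∀ x, u t x =ᵐ[P] mildField σ θ W P t x

/-- The pathwise spatial derivative `u_x(t, x)`. -/
def spatialDeriv {Ω : Type*} (u : ℝ → ℝ → Ω → ℝ) (t x : ℝ) (ω : Ω) : ℝ :=
  deriv (fun z => u t z ω) x

end

/-!
Formally `θ ∂ₓ² u = ∂ₜ u - σ Ẇ`, and `∂ₜ u` is `σ` times the white noise smoothed by the heat kernel
`p` at time `t`. Integrating once in space, `uₓ(t, x) = (σ / θ) ((p ∗ W)(x) - W(x))`. The field
`p ∗ W - W` is `IsTwoSidedBrownian.heatDefect`; everything follows from this representation.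

*The representation.* In `L²(P)`, the increment of the mild solution between `0` and `x` is
`(σ / θ) ∫₀ˣ heatDefect` (`mildField_sub_eq`). Both sides lie in the closed span of the values of
`W`, so it suffices to test them against each `W b`. By the isometry property of the Wiener
integral and the explicit covariance of `W`, this reduces to the identity
`θ ∫₀ᵗ p_s(z) ds = E|z - √(2θt) N| / 2 - |z| / 2` with `N` standard Gaussian
(`integral_heatKernel_time`).

*Pathwise differentiability.* A continuous modification of `W` can be smoothed pathwise, which gives
an almost surely continuous version of `heatDefect`. Bochner integrals in `L²(P)` agree almost
surely with pathwise integrals (`coeFn_integral_Lp_ae_eq`), so by continuity of `u` the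
representation of the increment holds almost surely for all `x` at once, and the fundamental theorem
of calculus gives the derivative (`IsMildSolution.exists_hasDerivAt`).

*The limit.* Over a distance `h` the increment of `W` has mean square exactly `h`, while the
increment of `p ∗ W` has mean square `O(h²)` and its correlation with the increment of `W` is also
`O(h²)`, since `p` is bounded (`IsTwoSidedBrownian.abs_norm_sq_heatDefect_sub_le`). With
`h = (B - A) / N` the error after multiplication by `N` is `O(1 / N)`, so it is negligible against
`N ^ (-α)` for every `α < 1`.
-/

/-! ### Pathwise integrals and Bochner integrals in `L²` -/

lemma integral_abs_le_Lp_norm {Ω : Type*} [MeasurableSpace Ω] {P : Measure Ω}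
    [IsProbabilityMeasure P] (f : Lp ℝ 2 P) : ∫ ω, ‖f ω‖ ∂P ≤ ‖f‖ := by
  rw [Lp.norm_def, integral_norm_eq_lintegral_enorm (Lp.aestronglyMeasurable f),
    ← eLpNorm_one_eq_lintegral_enorm]
  exact ENNReal.toReal_mono (Lp.eLpNorm_ne_top f)
    (eLpNorm_le_eLpNorm_of_exponent_le (by norm_num) (Lp.aestronglyMeasurable f))

/-- A jointly measurable version `X` of an integrable `L²(P)`-valued function is integrable on the
product space. -/
lemma integrable_prod_of_ae_eq_Lp {S Ω : Type*} [MeasurableSpace S] [MeasurableSpace Ω]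
    {μ : Measure S} [SFinite μ] {P : Measure Ω} [IsProbabilityMeasure P]
    {X : S → Ω → ℝ} (hX : AEStronglyMeasurable (Function.uncurry X) (μ.prod P))
    {F : S → Lp ℝ 2 P} (hF : Integrable F μ) (hXF : ∀ᵐ s ∂μ, X s =ᵐ[P] F s) :
    Integrable (Function.uncurry X) (μ.prod P) := by
  rw [integrable_prod_iff hX]
  constructor
  · filter_upwards [hXF] with s hs
    exact (((Lp.memLp (F s)).integrable (by norm_num)).congr hs.symm)
  · refine hF.norm.mono' hX.norm.integral_prod_right' ?_
    filter_upwards [hXF] with s hs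
    rw [Real.norm_of_nonneg (integral_nonneg fun _ => norm_nonneg _)]
    have : ∫ ω, ‖Function.uncurry X (s, ω)‖ ∂P = ∫ ω, ‖F s ω‖ ∂P :=
      integral_congr_ae (hs.mono fun ω h => by simp only [Function.uncurry]; rw [h])
    rw [this]
    exact integral_abs_le_Lp_norm _

/-- The Bochner integral of an `L²(P)`-valued function is almost surely the pathwise integral of
any jointly measurable version: both have the same integrals over events, by Fubini. -/
lemma coeFn_integral_Lp_ae_eq {S Ω : Type*} [MeasurableSpace S] [MeasurableSpace Ω]
    {μ : Measure S} [SFinite μ] {P : Measure Ω} [IsProbabilityMeasure P]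
    {X : S → Ω → ℝ} (hX : AEStronglyMeasurable (Function.uncurry X) (μ.prod P))
    {F : S → Lp ℝ 2 P} (hF : Integrable F μ) (hXF : ∀ᵐ s ∂μ, X s =ᵐ[P] F s) :
    ((∫ s, F s ∂μ : Lp ℝ 2 P) : Ω → ℝ) =ᵐ[P] fun ω => ∫ s, X s ω ∂μ := by
  have hint := integrable_prod_of_ae_eq_Lp hX hF hXF
  refine Integrable.ae_eq_of_forall_setIntegral_eq _ _
    ((Lp.memLp _).integrable (by norm_num)) hint.integral_prod_right ?_
  intro A hA _
  rw [← L2.inner_indicatorConstLp_one hA (measure_ne_top P A), ← integral_inner hF]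
  have hswap : ∫ ω in A, ∫ s, X s ω ∂μ ∂P = ∫ s, ∫ ω in A, X s ω ∂P ∂μ := by
    refine (integral_integral_swap (μ := μ) (ν := P.restrict A) (f := X) ?_).symm
    exact hint.mono_measure (Measure.prod_mono le_rfl Measure.restrict_le_self)
  rw [hswap]
  refine integral_congr_ae (hXF.mono fun s hs => ?_)
  simp only
  rw [L2.inner_indicatorConstLp_one hA (measure_ne_top P A)]
  exact integral_congr_ae (ae_restrict_of_ae hs.symm)

/-! ### Brownian motion as a curve in `L²` -/

section Brownian

variable {Ω : Type*} [MeasurableSpace Ω] {P : Measure Ω} {W : ℝ → Ω → ℝ}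

lemma IsTwoSidedBrownian.memLp (hW : IsTwoSidedBrownian W P) (x : ℝ) : MemLp (W x) 2 P :=
  (hW.isGaussianProcess.hasGaussianLaw_eval x).memLp_two

variable [IsProbabilityMeasure P]

/-- The class of `W x` in `L²(P)`. -/
noncomputable def IsTwoSidedBrownian.toLp (hW : IsTwoSidedBrownian W P) (x : ℝ) : Lp ℝ 2 P :=
  (hW.memLp x).toLp (W x)

lemma IsTwoSidedBrownian.inner_toLp (hW : IsTwoSidedBrownian W P) (x y : ℝ) :
    inner ℝ (hW.toLp x) (hW.toLp y) = (|x| + |y| - |x - y|) / 2 := by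
  rw [← hW.covariance_eq, covariance_eq_sub (hW.memLp x) (hW.memLp y), hW.mean_zero, L2.inner_def]
  simp only [zero_mul, sub_zero]
  refine integral_congr_ae ?_
  filter_upwards [(hW.memLp x).coeFn_toLp, (hW.memLp y).coeFn_toLp] with ω h1 h2
  simp only [IsTwoSidedBrownian.toLp, h1, h2, Pi.mul_apply]
  simp [mul_comm]

lemma IsTwoSidedBrownian.toLp_zero (hW : IsTwoSidedBrownian W P) : hW.toLp 0 = 0 := by
  rw [← inner_self_eq_zero (𝕜 := ℝ), hW.inner_toLp]; simp

lemma IsTwoSidedBrownian.norm_toLp_sub (hW : IsTwoSidedBrownian W P) (x y : ℝ) :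
    ‖hW.toLp x - hW.toLp y‖ = √|x - y| := by
  rw [norm_eq_sqrt_real_inner]
  congr 1
  simp only [inner_sub_left, inner_sub_right, hW.inner_toLp, sub_self, abs_zero, sub_zero,
    abs_sub_comm y x]
  ring

lemma IsTwoSidedBrownian.norm_toLp (hW : IsTwoSidedBrownian W P) (x : ℝ) :
    ‖hW.toLp x‖ = √|x| := by
  simpa [hW.toLp_zero] using hW.norm_toLp_sub x 0

lemma IsTwoSidedBrownian.continuous_toLp (hW : IsTwoSidedBrownian W P) :
    Continuous hW.toLp := by
  refine continuous_iff_continuousAt.2 fun x => ?_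
  rw [ContinuousAt, tendsto_iff_norm_sub_tendsto_zero]
  simp only [hW.norm_toLp_sub]
  have : Continuous fun y : ℝ => √|y - x| := by fun_prop
  simpa using this.tendsto x

/-! ### The Wiener integral -/

/-- The class of the indicator of `(a, b]` in `L²(ℝ)`. -/
noncomputable def iocLp (a b : ℝ) : Lp ℝ 2 (volume : Measure ℝ) :=
  indicatorConstLp 2 (measurableSet_Ioc (a := a) (b := b)) (by simp) 1

/-- The class of a step function in `L²(ℝ)`. -/
noncomputable def StepData.toLp (φ : StepData) : Lp ℝ 2 (volume : Measure ℝ) :=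
  ∑ i, φ.c i • iocLp (φ.a i) (φ.b i)

/-- The class in `L²(P)` of the elementary integral of a step function. -/
noncomputable def StepData.integralLp (φ : StepData) (hW : IsTwoSidedBrownian W P) : Lp ℝ 2 P :=
  ∑ i, φ.c i • (hW.toLp (φ.b i) - hW.toLp (φ.a i))

lemma StepData.coeFn_toLp (φ : StepData) : φ.toLp =ᵐ[volume] φ.toFun := by
  have h : ∀ i, ∀ᵐ y : ℝ, (φ.c i • iocLp (φ.a i) (φ.b i) : Lp ℝ 2 (volume : Measure ℝ)) y =
      φ.c i * (Set.Ioc (φ.a i) (φ.b i)).indicator (fun _ => (1 : ℝ)) y := fun i => by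
    filter_upwards [Lp.coeFn_smul (φ.c i) (iocLp (φ.a i) (φ.b i)),
      indicatorConstLp_coeFn (p := 2) (hs := measurableSet_Ioc (a := φ.a i) (b := φ.b i))
        (hμs := by simp) (c := (1 : ℝ)) (μ := volume)] with y h1 h2
    rw [h1, Pi.smul_apply, iocLp, h2, smul_eq_mul]
  filter_upwards [Lp.coeFn_fun_finsetSum Finset.univ (fun i => φ.c i • iocLp (φ.a i) (φ.b i)),
    ae_all_iff.2 h] with y h1 h2
  rw [StepData.toLp, h1, StepData.toFun]
  exact Finset.sum_congr rfl fun i _ => h2 i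

omit [IsProbabilityMeasure P] in
lemma StepData.coeFn_integralLp (φ : StepData) (hW : IsTwoSidedBrownian W P) :
    φ.integralLp hW =ᵐ[P] φ.integral W := by
  have h : ∀ i, ∀ᵐ ω ∂P, (φ.c i • (hW.toLp (φ.b i) - hW.toLp (φ.a i)) : Lp ℝ 2 P) ω =
      φ.c i * (W (φ.b i) ω - W (φ.a i) ω) := fun i => by
    filter_upwards [Lp.coeFn_smul (φ.c i) (hW.toLp (φ.b i) - hW.toLp (φ.a i)),
      Lp.coeFn_sub (hW.toLp (φ.b i)) (hW.toLp (φ.a i)),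
      (hW.memLp (φ.a i)).coeFn_toLp, (hW.memLp (φ.b i)).coeFn_toLp] with ω h1 h2 h3 h4
    rw [h1, Pi.smul_apply, h2, Pi.sub_apply, IsTwoSidedBrownian.toLp, IsTwoSidedBrownian.toLp,
      h3, h4, smul_eq_mul]
  filter_upwards [Lp.coeFn_fun_finsetSum Finset.univ
      (fun i => φ.c i • (hW.toLp (φ.b i) - hW.toLp (φ.a i))), ae_all_iff.2 h] with y h1 h2
  rw [StepData.integralLp, h1, StepData.integral]
  exact Finset.sum_congr rfl fun i _ => h2 i

omit [IsProbabilityMeasure P] in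
lemma hasWienerIntegral_iff (hW : IsTwoSidedBrownian W P) {f : ℝ → ℝ} (hf : MemLp f 2 volume)
    (X : Lp ℝ 2 P) : HasWienerIntegral W P f X ↔ ∃ φ : ℕ → StepData,
      Tendsto (fun k => (φ k).toLp) atTop (𝓝 (hf.toLp f)) ∧
      Tendsto (fun k => (φ k).integralLp hW) atTop (𝓝 X) := by
  refine exists_congr fun φ => and_congr ?_ ?_
  · rw [Lp.tendsto_Lp_iff_tendsto_eLpNorm']
    refine tendsto_congr fun k => eLpNorm_congr_ae ?_
    filter_upwards [(φ k).coeFn_toLp, hf.coeFn_toLp] with y h1 h2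
    simp [h1, h2]
  · rw [Lp.tendsto_Lp_iff_tendsto_eLpNorm']
    refine tendsto_congr fun k => eLpNorm_congr_ae ?_
    filter_upwards [(φ k).coeFn_integralLp hW] with y h1
    simp [h1]

/-- Increments of `W` have the inner products of the corresponding indicators. -/
lemma IsTwoSidedBrownian.inner_increment (hW : IsTwoSidedBrownian W P) {a b c d : ℝ} (hab : a ≤ b)
    (hcd : c ≤ d) : inner ℝ (hW.toLp b - hW.toLp a) (hW.toLp d - hW.toLp c)
      = inner ℝ (iocLp a b) (iocLp c d) := by
  rw [iocLp, iocLp, L2.real_inner_indicatorConstLp_one_indicatorConstLp_one _ _ (by simp) (by simp),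
    Set.Ioc_inter_Ioc,
    Real.volume_real_Ioc]
  simp only [inner_sub_left, inner_sub_right, hW.inner_toLp]
  have e : ∀ x y : ℝ, |x - y| = max x y - min x y := fun x y => (max_sub_min_eq_abs' x y).symm
  rw [e b d, e b c, e a d, e a c]
  grind

lemma StepData.inner_integralLp (hW : IsTwoSidedBrownian W P) (φ ψ : StepData) :
    inner ℝ (φ.integralLp hW) (ψ.integralLp hW) = inner ℝ φ.toLp ψ.toLp := by
  simp only [StepData.integralLp, StepData.toLp, sum_inner, inner_sum, inner_smul_left,
    inner_smul_right]
  simp only [hW.inner_increment (φ.a_le_b _) (ψ.a_le_b _)]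

lemma StepData.norm_integralLp_sub (hW : IsTwoSidedBrownian W P) (φ ψ : StepData) :
    ‖φ.integralLp hW - ψ.integralLp hW‖ = ‖φ.toLp - ψ.toLp‖ := by
  rw [← sq_eq_sq₀ (norm_nonneg _) (norm_nonneg _), norm_sub_sq_real, norm_sub_sq_real,
    ← real_inner_self_eq_norm_sq, ← real_inner_self_eq_norm_sq, ← real_inner_self_eq_norm_sq,
    ← real_inner_self_eq_norm_sq]
  simp only [StepData.inner_integralLp]

/-- Step functions are dense in `L²(ℝ)`: a function orthogonal to all of them has vanishing
integrals over intervals, hence vanishes by Lebesgue differentiation. -/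
lemma exists_stepData_tendsto (f : Lp ℝ 2 (volume : Measure ℝ)) :
    ∃ φ : ℕ → StepData, Tendsto (fun k => (φ k).toLp) atTop (𝓝 f) := by
  let K := Submodule.span ℝ {g : Lp ℝ 2 (volume : Measure ℝ) | ∃ a b, a ≤ b ∧ iocLp a b = g}
  have hK : Kᗮ = ⊥ := by
    rw [Submodule.eq_bot_iff]
    intro g hg
    have h0 : ∀ a b : ℝ, a ≤ b → ∫ y in a..b, g y = 0 := fun a b hab => by
      have := (Submodule.mem_orthogonal K g).1 hg (iocLp a b)
        (Submodule.subset_span ⟨a, b, hab, rfl⟩)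
      rwa [iocLp, L2.inner_indicatorConstLp_one, ← intervalIntegral.integral_of_le hab] at this
    have h0' : ∀ b : ℝ, ∫ y in (0 : ℝ)..b, g y = 0 := fun b => by
      rcases le_total 0 b with h | h
      · exact h0 _ _ h
      · rw [intervalIntegral.integral_symm, h0 _ _ h, neg_zero]
    have hloc : LocallyIntegrable g volume :=
      (Lp.memLp g).locallyIntegrable (by norm_num)
    rw [Lp.eq_zero_iff_ae_eq_zero]
    filter_upwards [LocallyIntegrable.ae_hasDerivAt_integral hloc] with x hx
    have := hx 0
    simp only [h0'] at this
    exact this.unique (hasDerivAt_const x (0 : ℝ))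
  have hf : f ∈ closure (K : Set (Lp ℝ 2 (volume : Measure ℝ))) := by
    have := (Submodule.topologicalClosure_eq_top_iff (K := K)).2 hK
    rw [← Submodule.topologicalClosure_coe, this]
    trivial
  obtain ⟨g, hgK, hg⟩ := mem_closure_iff_seq_limit.1 hf
  have hstep : ∀ k, ∃ φ : StepData, φ.toLp = g k := fun k => by
    obtain ⟨n, c, e, he⟩ := Submodule.mem_span_set'.1 (hgK k)
    choose a b hab hI using fun i => (e i).2
    exact ⟨⟨n, c, a, b, hab⟩, by simp only [StepData.toLp, hI]; exact he⟩
  choose φ hφ using hstep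
  exact ⟨φ, by simpa only [hφ] using hg⟩

lemma exists_hasWienerIntegral (hW : IsTwoSidedBrownian W P) {f : ℝ → ℝ}
    (hf : MemLp f 2 volume) : ∃ X, HasWienerIntegral W P f X := by
  obtain ⟨φ, hφ⟩ := exists_stepData_tendsto (hf.toLp f)
  have hc : CauchySeq fun k => (φ k).integralLp hW := by
    have := hφ.cauchySeq
    rw [Metric.cauchySeq_iff] at this ⊢
    simpa only [dist_eq_norm, StepData.norm_integralLp_sub] using this
  obtain ⟨X, hX⟩ := cauchySeq_tendsto_of_complete hc
  exact ⟨X, (hasWienerIntegral_iff hW hf X).2 ⟨φ, hφ, hX⟩⟩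

lemma hasWienerIntegral_wienerIntegral (hW : IsTwoSidedBrownian W P) {f : ℝ → ℝ}
    (hf : MemLp f 2 volume) : HasWienerIntegral W P f (wienerIntegral W P f) := by
  have h := exists_hasWienerIntegral hW hf
  rw [wienerIntegral, dif_pos h]
  exact h.choose_spec

/-- The Itô isometry for the Wiener integral. -/
lemma inner_wienerIntegral (hW : IsTwoSidedBrownian W P) {f g : ℝ → ℝ}
    (hf : MemLp f 2 volume) (hg : MemLp g 2 volume) :
    inner ℝ (wienerIntegral W P f) (wienerIntegral W P g) = ∫ y, f y * g y := by
  obtain ⟨φ, hφ, hφX⟩ := (hasWienerIntegral_iff hW hf _).1 (hasWienerIntegral_wienerIntegral hW hf)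
  obtain ⟨ψ, hψ, hψX⟩ := (hasWienerIntegral_iff hW hg _).1 (hasWienerIntegral_wienerIntegral hW hg)
  have h1 := hφX.inner (𝕜 := ℝ) hψX
  simp only [StepData.inner_integralLp] at h1
  rw [tendsto_nhds_unique h1 (hφ.inner (𝕜 := ℝ) hψ), L2.inner_def]
  refine integral_congr_ae ?_
  filter_upwards [hf.coeFn_toLp, hg.coeFn_toLp] with y h1 h2
  simp [h1, h2, mul_comm]

lemma inner_wienerIntegral_increment (hW : IsTwoSidedBrownian W P) {f : ℝ → ℝ}
    (hf : MemLp f 2 volume) {a b : ℝ} (hab : a ≤ b) :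
    inner ℝ (hW.toLp b - hW.toLp a) (wienerIntegral W P f) = ∫ y in a..b, f y := by
  obtain ⟨φ, hφ, hφX⟩ := (hasWienerIntegral_iff hW hf _).1 (hasWienerIntegral_wienerIntegral hW hf)
  let ψ : StepData := ⟨1, fun _ => 1, fun _ => a, fun _ => b, fun _ => hab⟩
  have hψ : ψ.integralLp hW = hW.toLp b - hW.toLp a := by simp [ψ, StepData.integralLp]
  have hψ' : ψ.toLp = iocLp a b := by simp [ψ, StepData.toLp]
  have h1 := (tendsto_const_nhds (x := ψ.integralLp hW)).inner (𝕜 := ℝ) hφX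
  simp only [StepData.inner_integralLp] at h1
  rw [← hψ, tendsto_nhds_unique h1 ((tendsto_const_nhds (x := ψ.toLp)).inner (𝕜 := ℝ) hφ), hψ',
    iocLp, L2.inner_indicatorConstLp_one, intervalIntegral.integral_of_le hab]
  exact integral_congr_ae (ae_restrict_of_ae hf.coeFn_toLp)

lemma inner_toLp_wienerIntegral (hW : IsTwoSidedBrownian W P) {f : ℝ → ℝ}
    (hf : MemLp f 2 volume) (b : ℝ) :
    inner ℝ (hW.toLp b) (wienerIntegral W P f) = ∫ y in (0 : ℝ)..b, f y := by
  rcases le_total 0 b with h | h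
  · simpa [hW.toLp_zero] using inner_wienerIntegral_increment hW hf h
  · have := inner_wienerIntegral_increment hW hf h
    rw [hW.toLp_zero, zero_sub, inner_neg_left] at this
    rw [intervalIntegral.integral_symm, ← this, neg_neg]

/-- Wiener integrals are limits of linear combinations of the values of `W`. -/
lemma inner_wienerIntegral_eq_zero (hW : IsTwoSidedBrownian W P) {f : ℝ → ℝ}
    (hf : MemLp f 2 volume) {Y : Lp ℝ 2 P} (hY : ∀ b, inner ℝ Y (hW.toLp b) = 0) :
    inner ℝ Y (wienerIntegral W P f) = 0 := by
  obtain ⟨φ, -, hφX⟩ := (hasWienerIntegral_iff hW hf _).1 (hasWienerIntegral_wienerIntegral hW hf)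
  refine tendsto_nhds_unique ((tendsto_const_nhds (x := Y)).inner (𝕜 := ℝ) hφX) ?_
  simp [StepData.integralLp, inner_sum, inner_smul_right, inner_sub_right, hY]

end Brownian

/-! ### The heat kernel -/

lemma heatKernel_eq (θ t x : ℝ) :
    heatKernel θ t x = (√(4 * Real.pi * θ * t))⁻¹ * Real.exp (-(4 * θ * t)⁻¹ * x ^ 2) := by
  rw [heatKernel]; congr 2; ring

lemma heatKernel_nonneg (θ t x : ℝ) : 0 ≤ heatKernel θ t x := by
  unfold heatKernel; positivity

lemma heatKernel_le {θ t : ℝ} (hθ : 0 ≤ θ) (ht : 0 ≤ t) (x : ℝ) :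
    heatKernel θ t x ≤ (√(4 * Real.pi * θ * t))⁻¹ := by
  rw [heatKernel_eq]
  refine mul_le_of_le_one_right (by positivity) (Real.exp_le_one_iff.2 ?_)
  have : 0 ≤ (4 * θ * t)⁻¹ * x ^ 2 := by positivity
  linarith

lemma continuous_heatKernel (θ t : ℝ) : Continuous (heatKernel θ t) := by
  unfold heatKernel; fun_prop

lemma measurable_heatKernel (θ : ℝ) : Measurable fun p : ℝ × ℝ => heatKernel θ p.1 p.2 := by
  unfold heatKernel; fun_prop

lemma integrable_heatKernel {θ t : ℝ} (hθ : 0 < θ) (ht : 0 < t) :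
    Integrable (heatKernel θ t) := by
  have := (integrable_exp_neg_mul_sq (b := (4 * θ * t)⁻¹) (by positivity)).const_mul
    (√(4 * Real.pi * θ * t))⁻¹
  exact this.congr (.of_forall fun x => (heatKernel_eq θ t x).symm)

lemma integral_heatKernel {θ t : ℝ} (hθ : 0 < θ) (ht : 0 < t) : ∫ x, heatKernel θ t x = 1 := by
  simp only [heatKernel_eq]
  rw [integral_const_mul, integral_gaussian, div_inv_eq_mul,
    show Real.pi * (4 * θ * t) = 4 * Real.pi * θ * t by ring]
  exact inv_mul_cancel₀ (by positivity)

lemma integrable_heatKernel_mul_abs {θ t : ℝ} (hθ : 0 < θ) (ht : 0 < t) :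
    Integrable fun x => heatKernel θ t x * |x| := by
  have := ((integrable_mul_exp_neg_mul_sq (b := (4 * θ * t)⁻¹) (by positivity)).abs).const_mul
    (√(4 * Real.pi * θ * t))⁻¹
  refine this.congr (.of_forall fun x => ?_)
  simp only [heatKernel_eq, abs_mul, Real.abs_exp]
  ring

lemma integrable_heatKernel_sub {θ t : ℝ} (hθ : 0 < θ) (ht : 0 < t) (x : ℝ) :
    Integrable fun y => heatKernel θ t (x - y) :=
  (integrable_heatKernel hθ ht).comp_sub_left x

lemma integrable_heatKernel_sub_mul_abs {θ t : ℝ} (hθ : 0 < θ) (ht : 0 < t) (x b : ℝ) :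
    Integrable fun y => heatKernel θ t (x - y) * |y - b| := by
  have h1 := (integrable_heatKernel_mul_abs hθ ht).comp_sub_left x
  have h2 := (integrable_heatKernel_sub hθ ht x).mul_const |x - b|
  refine (h1.add h2).mono' ?_ (.of_forall fun y => ?_)
  · exact (((continuous_heatKernel θ t).comp (by fun_prop)).mul
      (by fun_prop)).aestronglyMeasurable
  · rw [Real.norm_of_nonneg (mul_nonneg (heatKernel_nonneg _ _ _) (abs_nonneg _)), Pi.add_apply,
      ← mul_add]
    refine mul_le_mul_of_nonneg_left ?_ (heatKernel_nonneg _ _ _)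
    have := abs_sub_le y x b
    rw [abs_sub_comm y x] at this
    exact this

lemma integral_heatKernel_mul_heatKernel {θ s r : ℝ} (hθ : 0 < θ) (hs : 0 < s) (hr : 0 < r)
    (x : ℝ) : ∫ y, heatKernel θ s (x - y) * heatKernel θ r (x - y)
      = (√(4 * Real.pi * θ * (s + r)))⁻¹ := by
  rw [integral_sub_left_eq_self (fun y => heatKernel θ s y * heatKernel θ r y) volume x]
  have h : ∀ y, heatKernel θ s y * heatKernel θ r y
      = ((√(4 * Real.pi * θ * s))⁻¹ * (√(4 * Real.pi * θ * r))⁻¹) *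
        Real.exp (-((s + r) / (4 * θ * s * r)) * y ^ 2) := fun y => by
    rw [heatKernel_eq, heatKernel_eq, mul_mul_mul_comm, ← Real.exp_add]
    congr 2
    field_simp
    ring
  simp only [h]
  rw [integral_const_mul, integral_gaussian, ← mul_inv, ← Real.sqrt_mul (by positivity),
    ← Real.sqrt_inv, ← Real.sqrt_inv, ← Real.sqrt_mul (by positivity)]
  congr 1
  field_simp

lemma memLp_heatKernel_sub {θ t : ℝ} (hθ : 0 < θ) (ht : 0 < t) (x : ℝ) :
    MemLp (fun y => heatKernel θ t (x - y)) 2 volume := by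
  have hc : Continuous fun y => heatKernel θ t (x - y) :=
    (continuous_heatKernel θ t).comp (by fun_prop)
  rw [memLp_two_iff_integrable_sq hc.aestronglyMeasurable]
  have h := (integrable_heatKernel_sub hθ ht x).const_mul (√(4 * Real.pi * θ * t))⁻¹
  refine h.mono' (hc.pow 2).aestronglyMeasurable (.of_forall fun y => ?_)
  rw [Real.norm_of_nonneg (sq_nonneg _), sq]
  exact mul_le_mul_of_nonneg_right (heatKernel_le hθ.le ht.le _) (heatKernel_nonneg _ _ _)

/-! ### The time integral of the heat kernel -/

/-- The expectation of `|z - c * N| / 2` for a centred Gaussian variable `N` of variance `1/2`. -/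
noncomputable def gaussianHalfAbs (c z : ℝ) : ℝ :=
  (√Real.pi)⁻¹ * ∫ r, Real.exp (-r ^ 2) * (|z - c * r| / 2)

lemma integrable_exp_neg_sq : Integrable fun r : ℝ => Real.exp (-r ^ 2) := by
  simpa using integrable_exp_neg_mul_sq (b := 1) one_pos

lemma integrable_mul_exp_neg_sq : Integrable fun r : ℝ => r * Real.exp (-r ^ 2) := by
  simpa using integrable_mul_exp_neg_mul_sq (b := 1) one_pos

lemma integrable_exp_neg_sq_mul_abs (c z : ℝ) :
    Integrable fun r : ℝ => Real.exp (-r ^ 2) * (|z - c * r| / 2) := by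
  have h := ((integrable_exp_neg_sq.const_mul z).sub
    (integrable_mul_exp_neg_sq.const_mul c)).abs.div_const 2
  refine h.congr (.of_forall fun r => ?_)
  simp only [Pi.sub_apply]
  rw [show z * Real.exp (-r ^ 2) - c * (r * Real.exp (-r ^ 2)) = Real.exp (-r ^ 2) * (z - c * r)
    by ring, abs_mul, Real.abs_exp]
  ring

lemma gaussianHalfAbs_zero (z : ℝ) : gaussianHalfAbs 0 z = |z| / 2 := by
  rw [gaussianHalfAbs]
  simp only [zero_mul, sub_zero]
  rw [integral_mul_const]
  have := integral_gaussian 1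
  simp only [neg_mul, one_mul, div_one] at this
  rw [this]
  have : √Real.pi ≠ 0 := by positivity
  field_simp

lemma continuous_gaussianHalfAbs : Continuous fun p : ℝ × ℝ => gaussianHalfAbs p.1 p.2 := by
  refine continuous_const.mul (continuous_iff_continuousAt.2 fun p => ?_)
  have hb := ((integrable_exp_neg_sq.mul_const (|p.2| + 1)).add
    (integrable_mul_exp_neg_sq.abs.mul_const (|p.1| + 1)))
  refine continuousAt_of_dominated (bound := _) (.of_forall fun q => ?_) ?_ hb
    (.of_forall fun r => ?_)
  · exact (integrable_exp_neg_sq_mul_abs _ _).aestronglyMeasurable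
  · have h1 : ∀ᶠ q : ℝ × ℝ in 𝓝 p, |q.1| < |p.1| + 1 :=
      (continuous_abs.comp continuous_fst).continuousAt.eventually_lt continuousAt_const
        (by simp)
    have h2 : ∀ᶠ q : ℝ × ℝ in 𝓝 p, |q.2| < |p.2| + 1 :=
      (continuous_abs.comp continuous_snd).continuousAt.eventually_lt continuousAt_const
        (by simp)
    filter_upwards [h1, h2] with q h1 h2
    refine .of_forall fun r => ?_
    rw [Real.norm_of_nonneg (by positivity), Pi.add_apply, abs_mul, Real.abs_exp]
    have h3 : |q.2 - q.1 * r| ≤ |p.2| + 1 + (|p.1| + 1) * |r| :=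
      calc |q.2 - q.1 * r| ≤ |q.2| + |q.1 * r| := abs_sub _ _
        _ ≤ _ := by rw [abs_mul]; gcongr
    have h4 : |q.2 - q.1 * r| / 2 ≤ |p.2| + 1 + (|p.1| + 1) * |r| := by
      linarith [abs_nonneg (q.2 - q.1 * r)]
    calc _ ≤ Real.exp (-r ^ 2) * (|p.2| + 1 + (|p.1| + 1) * |r|) := by gcongr
      _ = _ := by ring
  · fun_prop

/-- The derivative in `c` is a Gaussian density: differentiating under the integral leaves the
integral of `r * sign (c * r - z)` against `exp (-r ^ 2)`, which is elementary. -/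
lemma hasDerivAt_gaussianHalfAbs {c : ℝ} (hc : 0 < c) (z : ℝ) :
    HasDerivAt (fun c => gaussianHalfAbs c z)
      ((√Real.pi)⁻¹ * (Real.exp (-(z / c) ^ 2) / 2)) c := by
  set q := z / c
  have hder : ∀ r : ℝ, HasDerivAt (fun r => -Real.exp (-r ^ 2)) (2 * r * Real.exp (-r ^ 2)) r :=
    fun r => by
      refine ((hasDerivAt_pow 2 r).fun_neg.exp).fun_neg.congr_deriv ?_
      norm_num
      ring
  have hint2 : Integrable fun r : ℝ => 2 * r * Real.exp (-r ^ 2) := by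
    simpa only [mul_assoc] using integrable_mul_exp_neg_sq.const_mul 2
  have hlim : Tendsto (fun r : ℝ => -Real.exp (-r ^ 2)) atTop (𝓝 0) := by
    rw [← neg_zero]
    exact (Real.tendsto_exp_neg_atTop_nhds_zero.comp (tendsto_pow_atTop two_ne_zero)).neg
  have hlim' : Tendsto (fun r : ℝ => -Real.exp (-r ^ 2)) atBot (𝓝 0) := by
    have := hlim.comp tendsto_neg_atBot_atTop
    refine this.congr fun r => ?_
    simp
  have hIoi : ∫ r in Set.Ioi q, 2 * r * Real.exp (-r ^ 2) = Real.exp (-q ^ 2) := by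
    rw [integral_Ioi_of_hasDerivAt_of_tendsto' (fun r _ => hder r) hint2.integrableOn hlim]
    simp
  have hodd : ∫ r : ℝ, 2 * r * Real.exp (-r ^ 2) = 0 := by
    rw [integral_of_hasDerivAt_of_tendsto hder hint2 hlim' hlim]; simp
  let F' : ℝ → ℝ := fun r => (Set.Ioi q).indicator (fun r => 2 * r * Real.exp (-r ^ 2)) r / 2
    - 2 * r * Real.exp (-r ^ 2) / 4
  have hF'int : ∫ r, F' r = Real.exp (-q ^ 2) / 2 := by
    simp only [F']
    rw [integral_sub ((hint2.indicator measurableSet_Ioi).div_const 2) (hint2.div_const 4),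
      integral_div, integral_div, integral_indicator measurableSet_Ioi, hIoi, hodd]
    simp
  rw [← hF'int]
  refine HasDerivAt.const_mul _ ?_
  refine (hasDerivAt_integral_of_dominated_loc_of_lip (F := fun c r =>
    Real.exp (-r ^ 2) * (|z - c * r| / 2)) (bound := fun r => |r * Real.exp (-r ^ 2)|)
    (s := Set.univ) (F' := F') univ_mem (.of_forall fun c =>
      (integrable_exp_neg_sq_mul_abs c z).aestronglyMeasurable)
    (integrable_exp_neg_sq_mul_abs c z) ?_ ?_ integrable_mul_exp_neg_sq.abs ?_).2
  · exact (((hint2.indicator measurableSet_Ioi).div_const 2).sub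
      (hint2.div_const 4)).aestronglyMeasurable
  · refine .of_forall fun r => ?_
    refine LipschitzWith.lipschitzOnWith (LipschitzWith.of_dist_le_mul fun c c' => ?_)
    rw [Real.dist_eq, Real.dist_eq, ← mul_sub, abs_mul, Real.abs_exp, Real.coe_nnabs, abs_abs,
      abs_mul, Real.abs_exp, ← sub_div, abs_div, abs_two]
    have h1 : |(|z - c * r| - |z - c' * r|)| ≤ |c - c'| * |r| := by
      refine (abs_abs_sub_abs_le _ _).trans (le_of_eq ?_)
      rw [← abs_mul, abs_sub_comm]; congr 1; ring
    have h2 : |(|z - c * r| - |z - c' * r|)| / 2 ≤ |c - c'| * |r| := by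
      linarith [abs_nonneg (|z - c * r| - |z - c' * r|)]
    calc _ ≤ Real.exp (-r ^ 2) * (|c - c'| * |r|) := by gcongr
      _ = _ := by ring
  · have hne : ∀ᵐ r : ℝ, r ≠ q := by simp [ae_iff]
    filter_upwards [hne] with r hr
    have hlin : HasDerivAt (fun c => z - c * r) (-r) c := by
      simpa using ((hasDerivAt_id c).mul_const r).const_sub z
    rcases lt_or_gt_of_ne hr with h | h
    · have hpos : 0 < z - c * r := by
        have := (lt_div_iff₀ hc).1 h; linarith
      have h1 := (((hasDerivAt_abs_pos hpos).comp c hlin).div_const 2).const_mul (Real.exp (-r ^ 2))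
      refine h1.congr_deriv ?_
      have : r ∉ Set.Ioi q := by simpa using h.le
      simp only [F', Set.indicator_of_notMem this]
      simp
      ring
    · have hneg : z - c * r < 0 := by
        have := (div_lt_iff₀ hc).1 h; linarith
      have h1 := (((hasDerivAt_abs_neg hneg).comp c hlin).div_const 2).const_mul (Real.exp (-r ^ 2))
      refine h1.congr_deriv ?_
      have : r ∈ Set.Ioi q := h
      simp only [F', Set.indicator_of_mem this]
      simp
      ring

/-- The heat kernel in terms of the Gaussian `exp (-r ^ 2)` at scale `√(4θt)`. -/
lemma heatKernel_eq_scaled {θ t : ℝ} (hθ : 0 < θ) (ht : 0 < t) (x : ℝ) :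
    heatKernel θ t x =
      (√(4 * θ * t))⁻¹ * ((√Real.pi)⁻¹ * Real.exp (-(x / √(4 * θ * t)) ^ 2)) := by
  rw [heatKernel, div_pow, Real.sq_sqrt (by positivity),
    show 4 * Real.pi * θ * t = (4 * θ * t) * Real.pi by ring, Real.sqrt_mul (by positivity),
    mul_inv, mul_assoc, neg_div]

lemma heatKernel_le_rpow {θ : ℝ} (hθ : 0 < θ) (s z : ℝ) :
    heatKernel θ s z ≤ (√(4 * Real.pi * θ))⁻¹ * |s ^ (-(1 / 2) : ℝ)| := by
  rcases le_or_gt s 0 with hs | hs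
  · have : √(4 * Real.pi * θ * s) = 0 :=
      Real.sqrt_eq_zero_of_nonpos (mul_nonpos_of_nonneg_of_nonpos (by positivity) hs)
    simp only [heatKernel, this, inv_zero, zero_mul]
    positivity
  · refine (heatKernel_le hθ.le hs.le z).trans (le_of_eq ?_)
    rw [abs_of_nonneg (by positivity), Real.sqrt_mul (by positivity), mul_inv,
      Real.rpow_neg hs.le, ← Real.sqrt_eq_rpow]

lemma integrable_heatKernel_time {θ : ℝ} (hθ : 0 < θ) (t z : ℝ) :
    IntervalIntegrable (fun s => heatKernel θ s z) volume 0 t := by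
  have h : IntervalIntegrable (fun s : ℝ => (√(4 * Real.pi * θ))⁻¹ * |s ^ (-(1 / 2) : ℝ)|)
      volume 0 t := (intervalIntegral.intervalIntegrable_rpow' (by norm_num)).abs.const_mul _
  refine h.mono_fun ((measurable_heatKernel θ).comp
    (measurable_id.prodMk measurable_const)).aestronglyMeasurable (.of_forall fun s => ?_)
  simp only
  rw [Real.norm_of_nonneg (heatKernel_nonneg _ _ _), Real.norm_of_nonneg (by positivity)]
  exact heatKernel_le_rpow hθ s z

lemma integral_heatKernel_swap {θ : ℝ} (hθ : 0 < θ) (t x b : ℝ) :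
    ∫ s in (0 : ℝ)..t, ∫ y in (0 : ℝ)..b, heatKernel θ s (x - y)
      = ∫ y in (0 : ℝ)..b, ∫ s in (0 : ℝ)..t, heatKernel θ s (x - y) := by
  have h1 : IntegrableOn (fun s : ℝ => (√(4 * Real.pi * θ))⁻¹ * |s ^ (-(1 / 2) : ℝ)|)
      (Set.uIoc 0 t) := intervalIntegrable_iff.1
    ((intervalIntegral.intervalIntegrable_rpow' (by norm_num)).abs.const_mul _)
  have h2 : IntegrableOn (fun _ : ℝ => (1 : ℝ)) (Set.uIoc 0 b) := by
    simp
  have h3 : Integrable (Function.uncurry fun s y => heatKernel θ s (x - y))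
      ((volume.restrict (Set.uIoc 0 t)).prod (volume.restrict (Set.uIoc 0 b))) := by
    refine (h1.mul_prod h2).mono' ?_ (.of_forall fun p => ?_)
    · exact ((measurable_heatKernel θ).comp (measurable_fst.prodMk
        (measurable_const.sub measurable_snd))).aestronglyMeasurable
    · simp only [Function.uncurry, mul_one]
      rw [Real.norm_of_nonneg (heatKernel_nonneg _ _ _)]
      exact heatKernel_le_rpow hθ _ _
  rw [Measure.prod_restrict] at h3
  exact intervalIntegral_intervalIntegral_swap h3

/-- The time integral of the heat kernel is the increment of the Gaussian mean of `|z - ·| / 2`,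
since `θ * heatKernel` is its time derivative (the heat equation with `|·|'' / 2 = δ₀`). -/
lemma integral_heatKernel_time {θ t : ℝ} (hθ : 0 < θ) (ht : 0 ≤ t) (z : ℝ) :
    ∫ s in (0 : ℝ)..t, heatKernel θ s z
      = θ⁻¹ * (gaussianHalfAbs (√(4 * θ * t)) z - |z| / 2) := by
  have hcont : Continuous fun s : ℝ => θ⁻¹ * gaussianHalfAbs (√(4 * θ * s)) z :=
    continuous_const.mul (continuous_gaussianHalfAbs.comp
      (((continuous_const.mul continuous_id).sqrt).prodMk continuous_const))
  rw [intervalIntegral.integral_eq_sub_of_hasDerivAt_of_le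
    (f := fun s => θ⁻¹ * gaussianHalfAbs (√(4 * θ * s)) z) ht hcont.continuousOn ?_
    (integrable_heatKernel_time hθ t z)]
  · simp only [mul_zero, Real.sqrt_zero, gaussianHalfAbs_zero]; ring
  · intro s hs
    have hs0 : 0 < s := hs.1
    have hpos : 0 < √(4 * θ * s) := by positivity
    have h1 : HasDerivAt (fun s => √(4 * θ * s)) (4 * θ / (2 * √(4 * θ * s))) s := by
      have := ((hasDerivAt_id s).const_mul (4 * θ)).sqrt (by simp only [id]; positivity)
      simpa using this
    have h2 := ((hasDerivAt_gaussianHalfAbs hpos z).comp s h1).const_mul θ⁻¹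
    refine h2.congr_deriv ?_
    rw [heatKernel_eq_scaled hθ hs0]
    field_simp
    norm_num

lemma integral_heatKernel_mul_abs {θ t : ℝ} (hθ : 0 < θ) (ht : 0 < t) (z b : ℝ) :
    ∫ y, heatKernel θ t (z - y) * |y - b| = 2 * gaussianHalfAbs (√(4 * θ * t)) (z - b) := by
  set c := √(4 * θ * t) with hc
  have hpos : 0 < c := by positivity
  have h1 := integral_sub_left_eq_self (fun y => heatKernel θ t y * |z - b - y|) volume z
  have h2 : ∀ y, heatKernel θ t (z - y) * |y - b|
      = heatKernel θ t (z - y) * |z - b - (z - y)| := fun y => by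
    congr 2; ring
  simp only [h2]
  rw [h1]
  have h3 := Measure.integral_comp_mul_left (fun y => heatKernel θ t y * |z - b - y|) c
  have h4 : ∀ r, heatKernel θ t (c * r) * |z - b - c * r|
      = (c⁻¹ * (√Real.pi)⁻¹ * 2) * (Real.exp (-r ^ 2) * (|z - b - c * r| / 2)) := fun r => by
    rw [heatKernel_eq_scaled hθ ht, ← hc, mul_div_cancel_left₀ _ hpos.ne']
    ring
  simp only [h4] at h3
  rw [integral_const_mul, abs_of_pos (inv_pos.2 hpos), smul_eq_mul] at h3
  rw [gaussianHalfAbs]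
  have h5 := congrArg (c * ·) h3
  simp only [← mul_assoc, mul_inv_cancel₀ hpos.ne', one_mul] at h5
  rw [← h5]
  ring

/-! ### The spatial derivative as a curve in `L²` -/

section Field

variable {Ω : Type*} [MeasurableSpace Ω] {P : Measure Ω} [IsProbabilityMeasure P] {W : ℝ → Ω → ℝ}

/-- The difference between `W`, smoothed by the heat kernel at time `t`, and `W` itself, as an
element of `L²(P)`. Up to the factor `σ / θ` this is the spatial derivative of the mild solution. -/
noncomputable def IsTwoSidedBrownian.heatDefect (hW : IsTwoSidedBrownian W P) (θ t x : ℝ) :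
    Lp ℝ 2 P :=
  (∫ y, heatKernel θ t (x - y) • hW.toLp y) - hW.toLp x

variable {θ t : ℝ}

lemma IsTwoSidedBrownian.integrable_heatKernel_smul (hW : IsTwoSidedBrownian W P) (hθ : 0 < θ)
    (ht : 0 < t) (x : ℝ) : Integrable fun y => heatKernel θ t (x - y) • hW.toLp y := by
  have h := (integrable_heatKernel_sub hθ ht x).add
    (integrable_heatKernel_sub_mul_abs hθ ht x 0)
  refine h.mono' ?_ (.of_forall fun y => ?_)
  · exact (((continuous_heatKernel θ t).comp (by fun_prop)).smul
      hW.continuous_toLp).aestronglyMeasurable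
  · rw [norm_smul, Real.norm_of_nonneg (heatKernel_nonneg _ _ _), hW.norm_toLp, Pi.add_apply,
      sub_zero, ← mul_one_add]
    refine mul_le_mul_of_nonneg_left ?_ (heatKernel_nonneg _ _ _)
    rw [Real.sqrt_le_left (by positivity)]
    nlinarith [abs_nonneg y]

lemma IsTwoSidedBrownian.integrable_heatKernel_smul' (hW : IsTwoSidedBrownian W P) (hθ : 0 < θ)
    (ht : 0 < t) (x : ℝ) : Integrable fun y => heatKernel θ t y • hW.toLp (x - y) := by
  simpa using (hW.integrable_heatKernel_smul hθ ht x).comp_sub_left x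

omit [IsProbabilityMeasure P] in
lemma IsTwoSidedBrownian.heatDefect_eq (hW : IsTwoSidedBrownian W P) (θ t x : ℝ) :
    hW.heatDefect θ t x = (∫ y, heatKernel θ t y • hW.toLp (x - y)) - hW.toLp x := by
  rw [IsTwoSidedBrownian.heatDefect]
  congr 1
  simpa using (integral_sub_left_eq_self
    (fun y => heatKernel θ t (x - y) • hW.toLp y) volume x).symm

lemma IsTwoSidedBrownian.continuous_heatDefect (hW : IsTwoSidedBrownian W P) (hθ : 0 < θ)
    (ht : 0 < t) : Continuous (hW.heatDefect θ t) := by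
  have h : Continuous fun x => ∫ y, heatKernel θ t y • hW.toLp (x - y) := by
    refine continuous_iff_continuousAt.2 fun x => ?_
    rw [ContinuousAt, tendsto_iff_norm_sub_tendsto_zero]
    have hsq : Tendsto (fun y : ℝ => √|y - x|) (𝓝 x) (𝓝 0) := by
      have : Continuous fun y : ℝ => √|y - x| := by fun_prop
      simpa using this.tendsto x
    refine squeeze_zero (fun _ => norm_nonneg _) (fun y => ?_) hsq
    rw [← integral_sub (hW.integrable_heatKernel_smul' hθ ht y)
      (hW.integrable_heatKernel_smul' hθ ht x)]
    have hb : ∀ z, ‖heatKernel θ t z • hW.toLp (y - z) - heatKernel θ t z • hW.toLp (x - z)‖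
        ≤ heatKernel θ t z * √|y - x| := fun z => by
      rw [← smul_sub, norm_smul, Real.norm_of_nonneg (heatKernel_nonneg _ _ _),
        hW.norm_toLp_sub, sub_sub_sub_cancel_right]
    refine (norm_integral_le_of_norm_le ((integrable_heatKernel hθ ht).mul_const _)
      (.of_forall hb)).trans (le_of_eq ?_)
    rw [integral_mul_const, integral_heatKernel hθ ht, one_mul]
  have := h.sub hW.continuous_toLp
  exact this.congr fun x => (hW.heatDefect_eq θ t x).symm

/-- The correction by which the heat semigroup at time `t` moves `|·| / 2`; it equals `θ` times the
time integral of the heat kernel over `[0, t]`. -/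
noncomputable def heatAbsDefect (θ t z : ℝ) : ℝ := gaussianHalfAbs (√(4 * θ * t)) z - |z| / 2

lemma continuous_heatAbsDefect (θ t : ℝ) : Continuous (heatAbsDefect θ t) :=
  (continuous_gaussianHalfAbs.comp (continuous_const.prodMk continuous_id)).sub
    (continuous_abs.div_const 2)

lemma IsTwoSidedBrownian.inner_toLp_heatDefect (hW : IsTwoSidedBrownian W P) (hθ : 0 < θ)
    (ht : 0 < t) (b x : ℝ) : inner ℝ (hW.toLp b) (hW.heatDefect θ t x)
      = heatAbsDefect θ t x - heatAbsDefect θ t (x - b) := by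
  rw [IsTwoSidedBrownian.heatDefect, inner_sub_right,
    ← integral_inner (hW.integrable_heatKernel_smul hθ ht x)]
  have h : ∀ y, inner ℝ (hW.toLp b) (heatKernel θ t (x - y) • hW.toLp y)
      = heatKernel θ t (x - y) * (|b| / 2) + heatKernel θ t (x - y) * |y - 0| / 2
        - heatKernel θ t (x - y) * |y - b| / 2 := fun y => by
    rw [inner_smul_right, hW.inner_toLp, sub_zero, abs_sub_comm b y]; ring
  simp only [h]
  have i1 := (integrable_heatKernel_sub hθ ht x).mul_const (|b| / 2)
  have i2 := (integrable_heatKernel_sub_mul_abs hθ ht x 0).div_const 2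
  have i3 := (integrable_heatKernel_sub_mul_abs hθ ht x b).div_const 2
  have i12 : Integrable fun y => heatKernel θ t (x - y) * (|b| / 2)
      + heatKernel θ t (x - y) * |y - 0| / 2 := i1.add i2
  rw [integral_sub i12 i3, integral_add i1 i2, integral_mul_const, integral_div,
    integral_div, integral_heatKernel_mul_abs hθ ht, integral_heatKernel_mul_abs hθ ht,
    integral_sub_left_eq_self (heatKernel θ t) volume x, integral_heatKernel hθ ht,
    hW.inner_toLp, heatAbsDefect, heatAbsDefect, sub_zero, abs_sub_comm b x]
  ring

lemma IsTwoSidedBrownian.inner_heatDefect_eq_zero (hW : IsTwoSidedBrownian W P) (hθ : 0 < θ)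
    (ht : 0 < t) {Y : Lp ℝ 2 P} (hY : ∀ b, inner ℝ Y (hW.toLp b) = 0) (x : ℝ) :
    inner ℝ Y (hW.heatDefect θ t x) = 0 := by
  rw [IsTwoSidedBrownian.heatDefect, inner_sub_right,
    ← integral_inner (hW.integrable_heatKernel_smul hθ ht x)]
  simp [inner_smul_right, hY]

/-! ### The mild solution -/

lemma norm_sq_wienerIntegral_heatKernel_sub (hW : IsTwoSidedBrownian W P) (hθ : 0 < θ) {s r : ℝ}
    (hs : 0 < s) (hr : 0 < r) (x : ℝ) :
    ‖wienerIntegral W P (fun y => heatKernel θ s (x - y))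
      - wienerIntegral W P (fun y => heatKernel θ r (x - y))‖ ^ 2
      = (√(4 * Real.pi * θ * (s + s)))⁻¹ - 2 * (√(4 * Real.pi * θ * (s + r)))⁻¹
        + (√(4 * Real.pi * θ * (r + r)))⁻¹ := by
  rw [norm_sub_sq_real, ← real_inner_self_eq_norm_sq, ← real_inner_self_eq_norm_sq,
    inner_wienerIntegral hW (memLp_heatKernel_sub hθ hs x) (memLp_heatKernel_sub hθ hs x),
    inner_wienerIntegral hW (memLp_heatKernel_sub hθ hs x) (memLp_heatKernel_sub hθ hr x),
    inner_wienerIntegral hW (memLp_heatKernel_sub hθ hr x) (memLp_heatKernel_sub hθ hr x),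
    integral_heatKernel_mul_heatKernel hθ hs hs, integral_heatKernel_mul_heatKernel hθ hs hr,
    integral_heatKernel_mul_heatKernel hθ hr hr]

lemma continuousOn_wienerIntegral_heatKernel (hW : IsTwoSidedBrownian W P) (hθ : 0 < θ) (x : ℝ) :
    ContinuousOn (fun s => wienerIntegral W P (fun y => heatKernel θ s (x - y))) (Set.Ioi 0) := by
  intro r hr
  have hr0 : (0 : ℝ) < r := hr
  rw [ContinuousWithinAt, tendsto_iff_norm_sub_tendsto_zero]
  have hk : ContinuousAt (fun s => (√(4 * Real.pi * θ * (s + s)))⁻¹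
      - 2 * (√(4 * Real.pi * θ * (s + r)))⁻¹ + (√(4 * Real.pi * θ * (r + r)))⁻¹) r := by
    have : √(4 * Real.pi * θ * (r + r)) ≠ 0 := by positivity
    fun_prop (disch := assumption)
  have h0 : Tendsto (fun s => ‖wienerIntegral W P (fun y => heatKernel θ s (x - y))
      - wienerIntegral W P (fun y => heatKernel θ r (x - y))‖ ^ 2) (𝓝[Set.Ioi 0] r) (𝓝 0) := by
    have h1 := hk.tendsto.mono_left (nhdsWithin_le_nhds (s := Set.Ioi 0))
    rw [show (√(4 * Real.pi * θ * (r + r)))⁻¹ - 2 * (√(4 * Real.pi * θ * (r + r)))⁻¹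
      + (√(4 * Real.pi * θ * (r + r)))⁻¹ = 0 by ring] at h1
    refine h1.congr' ?_
    filter_upwards [self_mem_nhdsWithin] with s hs
    exact (norm_sq_wienerIntegral_heatKernel_sub hW hθ hs hr0 x).symm
  have h2 := h0.sqrt
  simpa using h2

lemma norm_wienerIntegral_heatKernel (hW : IsTwoSidedBrownian W P) (hθ : 0 < θ) {s : ℝ}
    (hs : 0 < s) (x : ℝ) : ‖wienerIntegral W P (fun y => heatKernel θ s (x - y))‖
      = (8 * Real.pi * θ) ^ (-(1 / 4) : ℝ) * s ^ (-(1 / 4) : ℝ) := by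
  rw [norm_eq_sqrt_real_inner,
    inner_wienerIntegral hW (memLp_heatKernel_sub hθ hs x) (memLp_heatKernel_sub hθ hs x),
    integral_heatKernel_mul_heatKernel hθ hs hs, ← Real.mul_rpow (by positivity) hs.le,
    Real.sqrt_eq_rpow, Real.sqrt_eq_rpow, ← Real.rpow_neg (by positivity),
    ← Real.rpow_mul (by positivity)]
  congr 1
  · ring
  · norm_num

/-- The Wiener integrals of the heat kernel are integrable up to time `0`, where their norm is of
order `s ^ (-1/4)`. -/
lemma intervalIntegrable_wienerIntegral_heatKernel (hW : IsTwoSidedBrownian W P) (hθ : 0 < θ)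
    (ht : 0 ≤ t) (x : ℝ) :
    IntervalIntegrable (fun s => wienerIntegral W P (fun y => heatKernel θ s (x - y)))
      volume 0 t := by
  have h : IntervalIntegrable
      (fun s : ℝ => (8 * Real.pi * θ) ^ (-(1 / 4) : ℝ) * s ^ (-(1 / 4) : ℝ)) volume 0 t :=
    (intervalIntegral.intervalIntegrable_rpow' (by norm_num)).const_mul _
  rw [intervalIntegrable_iff_integrableOn_Ioc_of_le ht] at h ⊢
  refine Integrable.mono' h (((continuousOn_wienerIntegral_heatKernel hW hθ x).mono
    fun s hs => hs.1).aestronglyMeasurable measurableSet_Ioc) ?_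
  refine (ae_restrict_iff' measurableSet_Ioc).2 (.of_forall fun s hs => ?_)
  exact (norm_wienerIntegral_heatKernel hW hθ hs.1 x).le

lemma mildField_eq (σ θ : ℝ) (W : ℝ → Ω → ℝ) (P : Measure Ω) (t x : ℝ) : mildField σ θ W P t x
    = σ • ∫ s in (0 : ℝ)..t, wienerIntegral W P (fun y => heatKernel θ s (x - y)) := by
  rw [mildField, intervalIntegral.integral_comp_sub_left
    (fun s => wienerIntegral W P (fun y => heatKernel θ s (x - y))) t, sub_self, sub_zero]

lemma intervalIntegral_inner {E : Type*} [NormedAddCommGroup E] [InnerProductSpace ℝ E]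
    [CompleteSpace E] {f : ℝ → E} {a b : ℝ} (hf : IntervalIntegrable f volume a b) (c : E) :
    inner ℝ c (∫ s in a..b, f s) = ∫ s in a..b, inner ℝ c (f s) :=
  ((innerSL ℝ c).intervalIntegral_comp_comm hf).symm

lemma inner_toLp_integral_wienerIntegral (hW : IsTwoSidedBrownian W P) (hθ : 0 < θ)
    (ht : 0 ≤ t) (x b : ℝ) : inner ℝ (hW.toLp b)
        (∫ s in (0 : ℝ)..t, wienerIntegral W P (fun y => heatKernel θ s (x - y)))
      = θ⁻¹ * ∫ y in (0 : ℝ)..b, heatAbsDefect θ t (x - y) := by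
  rw [intervalIntegral_inner (intervalIntegrable_wienerIntegral_heatKernel hW hθ ht x)]
  have h : ∫ s in (0 : ℝ)..t, inner ℝ (hW.toLp b)
        (wienerIntegral W P (fun y => heatKernel θ s (x - y)))
      = ∫ s in (0 : ℝ)..t, ∫ y in (0 : ℝ)..b, heatKernel θ s (x - y) := by
    refine intervalIntegral.integral_congr_ae (.of_forall fun s hs => ?_)
    rw [Set.uIoc_of_le ht] at hs
    exact inner_toLp_wienerIntegral hW (memLp_heatKernel_sub hθ hs.1 x) b
  rw [h, integral_heatKernel_swap hθ, ← intervalIntegral.integral_const_mul]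
  simp only [integral_heatKernel_time hθ ht, heatAbsDefect]

/-- The increment of the mild solution is the integral of its spatial derivative. Both sides lie in
the closed linear span of the values of `W`, so it suffices to compare their inner products with
these values. -/
lemma mildField_sub_eq (hW : IsTwoSidedBrownian W P) (σ : ℝ) (hθ : 0 < θ) (ht : 0 < t) (x : ℝ) :
    mildField σ θ W P t x - mildField σ θ W P t 0
      = (σ / θ) • ∫ z in (0 : ℝ)..x, hW.heatDefect θ t z := by
  rw [mildField_eq, mildField_eq, ← smul_sub, div_eq_mul_inv, mul_smul]
  congr 1
  have hint := fun x => intervalIntegrable_wienerIntegral_heatKernel hW hθ ht.le x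
  have hVint : IntervalIntegrable (hW.heatDefect θ t) volume 0 x :=
    (hW.continuous_heatDefect hθ ht).intervalIntegrable _ _
  have hA := fun a b => (continuous_heatAbsDefect θ t).intervalIntegrable (μ := volume) a b
  have hA' : ∀ b, IntervalIntegrable (fun z => heatAbsDefect θ t (z - b)) volume 0 x := fun b =>
    ((continuous_heatAbsDefect θ t).comp (by fun_prop)).intervalIntegrable _ _
  rw [← sub_eq_zero]
  set Z := (∫ s in (0 : ℝ)..t, wienerIntegral W P (fun y => heatKernel θ s (x - y)))
    - (∫ s in (0 : ℝ)..t, wienerIntegral W P (fun y => heatKernel θ s (0 - y)))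
    - θ⁻¹ • ∫ z in (0 : ℝ)..x, hW.heatDefect θ t z with hZ
  have hZW : ∀ b, inner ℝ (hW.toLp b) Z = 0 := fun b => by
    rw [hZ, inner_sub_right, inner_sub_right, inner_toLp_integral_wienerIntegral hW hθ ht.le,
      inner_toLp_integral_wienerIntegral hW hθ ht.le, inner_smul_right,
      intervalIntegral_inner hVint]
    simp only [hW.inner_toLp_heatDefect hθ ht]
    rw [intervalIntegral.integral_sub (hA _ _) (hA' b),
      intervalIntegral.integral_comp_sub_left (heatAbsDefect θ t),
      intervalIntegral.integral_comp_sub_left (heatAbsDefect θ t),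
      intervalIntegral.integral_comp_sub_right (heatAbsDefect θ t),
      ← mul_sub, ← mul_sub, sub_zero, sub_zero, zero_sub,
      ← intervalIntegral.integral_add_adjacent_intervals (hA (x - b) 0) (hA 0 x),
      ← intervalIntegral.integral_add_adjacent_intervals (hA (-b) 0) (hA 0 (x - b)),
      intervalIntegral.integral_symm 0 (x - b)]
    ring
  -- Orthogonality of `Z` to all values of `W` passes to the span, hence to `Z` itself.
  rw [← inner_self_eq_zero (𝕜 := ℝ)]
  have hZW' : ∀ b, inner ℝ Z (hW.toLp b) = 0 := fun b => by rw [real_inner_comm]; exact hZW b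
  have h1 : ∀ x, inner ℝ Z
      (∫ s in (0 : ℝ)..t, wienerIntegral W P (fun y => heatKernel θ s (x - y))) = 0 := fun x => by
    rw [intervalIntegral_inner (hint x)]
    refine intervalIntegral.integral_zero_ae (.of_forall fun s hs => ?_)
    rw [Set.uIoc_of_le ht.le] at hs
    exact inner_wienerIntegral_eq_zero hW (memLp_heatKernel_sub hθ hs.1 x) hZW'
  have h2 : inner ℝ Z (∫ z in (0 : ℝ)..x, hW.heatDefect θ t z) = 0 := by
    rw [intervalIntegral_inner hVint]
    simp [hW.inner_heatDefect_eq_zero hθ ht hZW']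
  show inner ℝ Z (_ - _ - θ⁻¹ • _) = 0
  rw [inner_sub_right, inner_sub_right, h1, h1, inner_smul_right, h2]
  simp

end Field

section Increments

variable {Ω : Type*} [MeasurableSpace Ω] {P : Measure Ω} [IsProbabilityMeasure P] {W : ℝ → Ω → ℝ}
variable {θ t : ℝ}

/-! ### Mean square increments of the derivative -/

lemma IsTwoSidedBrownian.inner_shifted_increment (hW : IsTwoSidedBrownian W P) (x h y z : ℝ) :
    inner ℝ (hW.toLp (x + h - y) - hW.toLp (x - y)) (hW.toLp (x + h - z) - hW.toLp (x - z))
      = (|z - y + h| + |z - y - h|) / 2 - |z - y| := by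
  simp only [inner_sub_left, inner_sub_right, hW.inner_toLp]
  rw [show x + h - y - (x + h - z) = z - y by ring, show x + h - y - (x - z) = z - y + h by ring,
    show x - y - (x + h - z) = z - y - h by ring, show x - y - (x - z) = z - y by ring]
  ring

lemma abs_second_difference_nonneg (r h : ℝ) : 0 ≤ (|r + h| + |r - h|) / 2 - |r| := by
  have := abs_add_le (r + h) (r - h)
  rw [show r + h + (r - h) = 2 * r by ring, abs_mul, abs_two] at this
  linarith

lemma abs_second_difference_le {h : ℝ} (hh : 0 ≤ h) (z y : ℝ) :
    (|z - y + h| + |z - y - h|) / 2 - |z - y|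
      ≤ (Set.Icc (z - h) (z + h)).indicator (fun _ => h) y := by
  by_cases hy : y ∈ Set.Icc (z - h) (z + h)
  · rw [Set.indicator_of_mem hy]
    have h1 := abs_add_le (z - y) h
    have h2 := abs_sub (z - y) h
    rw [abs_of_nonneg hh] at h1 h2
    linarith
  · rw [Set.indicator_of_notMem hy]
    rw [Set.mem_Icc, not_and_or, not_le, not_le] at hy
    rcases hy with hy | hy
    · rw [abs_of_nonneg (by linarith : 0 ≤ z - y + h), abs_of_nonneg (by linarith : 0 ≤ z - y - h),
        abs_of_nonneg (by linarith : 0 ≤ z - y)]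
      linarith
    · rw [abs_of_nonpos (by linarith : z - y + h ≤ 0), abs_of_nonpos (by linarith : z - y - h ≤ 0),
        abs_of_nonpos (by linarith : z - y ≤ 0)]
      linarith

/-- The mean square increment of the derivative over a distance `h` is `h + O(h²)`. The increment of
`W` contributes `h`; the increment of the smoothed motion is an average of increments of `W` over
intervals of length `h`, and the heat kernel gives mass `O(h)` to those which meet a given one. -/
lemma IsTwoSidedBrownian.abs_norm_sq_heatDefect_sub_le (hW : IsTwoSidedBrownian W P) (hθ : 0 < θ)
    (ht : 0 < t) (x : ℝ) {h : ℝ} (hh : 0 ≤ h) :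
    |‖hW.heatDefect θ t (x + h) - hW.heatDefect θ t x‖ ^ 2 - h|
      ≤ 4 * (√(4 * Real.pi * θ * t))⁻¹ * h ^ 2 := by
  set C := (√(4 * Real.pi * θ * t))⁻¹ with hC
  have hC0 : 0 ≤ C := by positivity
  let e : ℝ → Lp ℝ 2 P := fun y => hW.toLp (x + h - y) - hW.toLp (x - y)
  have he : Integrable fun y => heatKernel θ t y • e y := by
    simp only [e, smul_sub]
    exact (hW.integrable_heatKernel_smul' hθ ht (x + h)).sub
      (hW.integrable_heatKernel_smul' hθ ht x)
  set J := ∫ y, heatKernel θ t y • e y with hJ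
  have hdiff : hW.heatDefect θ t (x + h) - hW.heatDefect θ t x = J - e 0 := by
    rw [hW.heatDefect_eq, hW.heatDefect_eq, hJ]
    simp only [e, smul_sub, sub_zero]
    rw [integral_sub (hW.integrable_heatKernel_smul' hθ ht (x + h))
      (hW.integrable_heatKernel_smul' hθ ht x)]
    abel
  have hinner : ∀ z, inner ℝ (e z) J
      = ∫ y, heatKernel θ t y * ((|z - y + h| + |z - y - h|) / 2 - |z - y|) := fun z => by
    rw [hJ, ← integral_inner he]
    refine integral_congr_ae (.of_forall fun y => ?_)
    simp only [e]
    rw [inner_smul_right, real_inner_comm, hW.inner_shifted_increment]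
  have hlow : ∀ z, 0 ≤ inner ℝ (e z) J := fun z => by
    rw [hinner]
    exact integral_nonneg fun y =>
      mul_nonneg (heatKernel_nonneg _ _ _) (abs_second_difference_nonneg _ _)
  have hup : ∀ z, inner ℝ (e z) J ≤ 2 * C * h ^ 2 := fun z => by
    rw [hinner]
    have hi : Integrable fun y => C * (Set.Icc (z - h) (z + h)).indicator (fun _ => h) y :=
      ((integrable_indicator_iff measurableSet_Icc).2 (by simp)).const_mul C
    calc ∫ y, heatKernel θ t y * ((|z - y + h| + |z - y - h|) / 2 - |z - y|)
        ≤ ∫ y, C * (Set.Icc (z - h) (z + h)).indicator (fun _ => h) y := by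
          refine integral_mono_of_nonneg (.of_forall fun y => mul_nonneg (heatKernel_nonneg _ _ _)
            (abs_second_difference_nonneg _ _)) hi (.of_forall fun y => ?_)
          exact mul_le_mul (heatKernel_le hθ.le ht.le y) (abs_second_difference_le hh z y)
            (abs_second_difference_nonneg _ _) hC0
      _ = 2 * C * h ^ 2 := by
          rw [integral_const_mul, integral_indicator measurableSet_Icc, setIntegral_const,
            Real.volume_real_Icc_of_le (by linarith), smul_eq_mul]
          ring
  have hJJ : ‖J‖ ^ 2 ≤ 2 * C * h ^ 2 := by
    rw [← real_inner_self_eq_norm_sq]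
    have h1 : inner ℝ J J = ∫ z, heatKernel θ t z * inner ℝ (e z) J := by
      conv_lhs => rw [hJ]
      rw [← hJ, ← integral_inner he]
      refine integral_congr_ae (.of_forall fun z => ?_)
      simp only
      rw [inner_smul_right, real_inner_comm]
    rw [h1]
    calc ∫ z, heatKernel θ t z * inner ℝ (e z) J ≤ ∫ z, heatKernel θ t z * (2 * C * h ^ 2) := by
          refine integral_mono_of_nonneg (.of_forall fun z => mul_nonneg (heatKernel_nonneg _ _ _)
            (hlow z)) ((integrable_heatKernel hθ ht).mul_const _) (.of_forall fun z => ?_)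
          exact mul_le_mul_of_nonneg_left (hup z) (heatKernel_nonneg _ _ _)
      _ = 2 * C * h ^ 2 := by rw [integral_mul_const, integral_heatKernel hθ ht, one_mul]
  have he0 : ‖e 0‖ ^ 2 = h := by
    simp only [e, sub_zero]
    rw [hW.norm_toLp_sub, Real.sq_sqrt (abs_nonneg _), add_sub_cancel_left, abs_of_nonneg hh]
  rw [hdiff, norm_sub_sq_real, he0, real_inner_comm, abs_le]
  have := hlow 0
  have := hup 0
  have : 0 ≤ C * h ^ 2 := by positivity
  constructor <;> nlinarith [sq_nonneg ‖J‖]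

/-! ### A continuous version of the derivative -/

omit [IsProbabilityMeasure P] in
/-- A two-sided Brownian motion is almost surely equal to a process with measurable marginals and
everywhere continuous paths. -/
lemma IsTwoSidedBrownian.exists_continuous_modification (hW : IsTwoSidedBrownian W P) :
    ∃ V : ℝ → Ω → ℝ, (∀ ω, Continuous fun x => V x ω) ∧ (∀ x, Measurable (V x)) ∧
      ∀ x, V x =ᵐ[P] W x := by
  have hm : ∀ x, AEMeasurable (W x) P := hW.isGaussianProcess.aemeasurable
  let G : Set Ω := {ω | (Continuous fun x => W x ω) ∧ ∀ q : ℚ, W q ω = (hm q).mk (W q) ω}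
  have hG : ∀ᵐ ω ∂P, ω ∈ G :=
    hW.continuous_paths.and (ae_all_iff.2 fun q : ℚ => (hm q).ae_eq_mk)
  let E : Set Ω := (toMeasurable P Gᶜ)ᶜ
  have hE : MeasurableSet E := (measurableSet_toMeasurable _ _).compl
  have hEG : ∀ ω ∈ E, ω ∈ G := fun ω hω => by
    by_contra h
    exact hω (subset_toMeasurable P Gᶜ h)
  have hEae : ∀ᵐ ω ∂P, ω ∈ E := by
    rw [ae_iff]
    simp only [E, Set.mem_compl_iff, not_not, Set.ofPred_mem_eq, measure_toMeasurable]
    exact hG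
  have hcont : ∀ ω, Continuous fun x => E.indicator (W x) ω := fun ω => by
    by_cases h : ω ∈ E
    · simpa only [Set.indicator_of_mem h] using (hEG ω h).1
    · simpa only [Set.indicator_of_notMem h] using continuous_const
  refine ⟨fun x => E.indicator (W x), hcont, fun x => ?_, fun x => ?_⟩
  · obtain ⟨v, hv, hvx⟩ := mem_closure_iff_seq_limit.1 (Rat.denseRange_cast (𝕜 := ℝ) x)
    choose q hq using hv
    refine measurable_of_tendsto_metrizable (f := fun n => E.indicator (W (v n))) (fun n => ?_)
      (tendsto_pi_nhds.2 fun ω => ((hcont ω).tendsto x).comp hvx)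
    have : E.indicator (W (v n)) = E.indicator ((hm (q n)).mk (W (q n))) := by
      ext ω
      by_cases h : ω ∈ E
      · rw [Set.indicator_of_mem h, Set.indicator_of_mem h, ← hq n]
        exact (hEG ω h).2 (q n)
      · rw [Set.indicator_of_notMem h, Set.indicator_of_notMem h]
    rw [this]
    exact (hm (q n)).measurable_mk.indicator hE
  · filter_upwards [hEae] with ω hω
    exact Set.indicator_of_mem hω _

lemma heatKernel_sub_le {θ t : ℝ} (hθ : 0 < θ) (ht : 0 < t) {x R : ℝ} (hx : x ^ 2 ≤ R) (y : ℝ) :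
    heatKernel θ t (x - y) ≤ (√(4 * Real.pi * θ * t))⁻¹ * √(4 * Real.pi * θ * (2 * t))
      * Real.exp (R / (4 * θ * t)) * heatKernel θ (2 * t) (0 - y) := by
  have hne : √(4 * Real.pi * θ * (2 * t)) ≠ 0 := by positivity
  have h : -(x - y) ^ 2 / (4 * θ * t) ≤ R / (4 * θ * t) + -(0 - y) ^ 2 / (4 * θ * (2 * t)) := by
    rw [show -(0 - y) ^ 2 / (4 * θ * (2 * t)) = -(y ^ 2 / 2) / (4 * θ * t) by field_simp; ring,
      ← add_div]
    refine div_le_div_of_nonneg_right ?_ (by positivity)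
    nlinarith [sq_nonneg (y - 2 * x)]
  calc heatKernel θ t (x - y)
      ≤ (√(4 * Real.pi * θ * t))⁻¹ *
        (Real.exp (R / (4 * θ * t)) * Real.exp (-(0 - y) ^ 2 / (4 * θ * (2 * t)))) := by
        rw [heatKernel, ← Real.exp_add]
        gcongr
    _ = _ := by
        rw [heatKernel]
        field_simp

/-- Pathwise, smoothing a continuous modification of `W` by the heat kernel and subtracting it gives
an almost surely continuous version of `heatDefect`, whose pathwise integrals are the Bochner
integrals of `heatDefect`. -/
lemma IsTwoSidedBrownian.exists_heatDefect_version (hW : IsTwoSidedBrownian W P) (hθ : 0 < θ)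
    (ht : 0 < t) : ∃ Z : ℝ → Ω → ℝ, (∀ᵐ ω ∂P, Continuous fun x => Z x ω) ∧
      (∀ x, Z x =ᵐ[P] hW.heatDefect θ t x) ∧
      ∀ x, (fun ω => ∫ z in (0 : ℝ)..x, Z z ω)
        =ᵐ[P] (∫ z in (0 : ℝ)..x, hW.heatDefect θ t z : Lp ℝ 2 P) := by
  obtain ⟨V, hVc, hVm, hVW⟩ := hW.exists_continuous_modification
  have hVu : Measurable (Function.uncurry V) :=
    measurable_uncurry_of_continuous_of_measurable hVc hVm
  have hKm : ∀ s, Measurable (heatKernel θ s) := fun s => (continuous_heatKernel θ s).measurable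
  have hVL : ∀ x, V x =ᵐ[P] hW.toLp x := fun x => (hVW x).trans (hW.memLp x).coeFn_toLp.symm
  have hker : ∀ s x y, (fun ω => heatKernel θ s (x - y) * V y ω)
      =ᵐ[P] (heatKernel θ s (x - y) • hW.toLp y : Lp ℝ 2 P) := fun s x y => by
    filter_upwards [hVL y, Lp.coeFn_smul (heatKernel θ s (x - y)) (hW.toLp y)] with ω h1 h2
    rw [h2, Pi.smul_apply, h1, smul_eq_mul]
  have hprod : ∀ s x, AEStronglyMeasurable
      (Function.uncurry fun y ω => heatKernel θ s (x - y) * V y ω) (volume.prod P) := fun s x =>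
    (((hKm s).comp (measurable_const.sub measurable_fst)).mul hVu).aestronglyMeasurable
  let Z : ℝ → Ω → ℝ := fun x ω => (∫ y, heatKernel θ t (x - y) * V y ω) - V x ω
  have hZ : ∀ x, Z x =ᵐ[P] hW.heatDefect θ t x := fun x => by
    filter_upwards [coeFn_integral_Lp_ae_eq (hprod t x) (hW.integrable_heatKernel_smul hθ ht x)
      (.of_forall fun y => hker t x y), hVL x,
      Lp.coeFn_sub (∫ y, heatKernel θ t (x - y) • hW.toLp y) (hW.toLp x)] with ω h1 h2 h3
    rw [IsTwoSidedBrownian.heatDefect, h3, Pi.sub_apply, h1, ← h2]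
  have hZm : StronglyMeasurable (Function.uncurry Z) := by
    have h1 : StronglyMeasurable fun p : (ℝ × Ω) × ℝ =>
        heatKernel θ t (p.1.1 - p.2) * V p.2 p.1.2 :=
      (((hKm t).comp ((measurable_fst.comp measurable_fst).sub measurable_snd)).mul
        (hVu.comp (measurable_snd.prodMk
          (measurable_snd.comp measurable_fst)))).stronglyMeasurable
    exact (h1.integral_prod_right' (ν := volume)).sub hVu.stronglyMeasurable
  refine ⟨Z, ?_, hZ, fun x => ?_⟩
  · -- Near a point, the kernel at time `t` is dominated by the kernel at time `2 * t`.
    have hint := (integrable_prod_of_ae_eq_Lp (hprod (2 * t) 0)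
      (hW.integrable_heatKernel_smul hθ (by positivity) 0)
      (.of_forall fun y => hker (2 * t) 0 y)).prod_left_ae
    filter_upwards [hint] with ω hω
    refine Continuous.sub (continuous_iff_continuousAt.2 fun x => ?_) (hVc ω)
    have hb := hω.norm.const_mul ((√(4 * Real.pi * θ * t))⁻¹ * √(4 * Real.pi * θ * (2 * t))
      * Real.exp ((x ^ 2 + 1) / (4 * θ * t)))
    refine continuousAt_of_dominated (.of_forall fun z => ?_) ?_ hb (.of_forall fun y => ?_)
    · exact (((hKm t).comp (measurable_const.sub measurable_id)).mul
        (hVc ω).measurable).aestronglyMeasurable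
    · have h1 : ∀ᶠ z : ℝ in 𝓝 x, z ^ 2 < x ^ 2 + 1 :=
        (continuous_pow 2).continuousAt.eventually_lt continuousAt_const (by simp)
      filter_upwards [h1] with z hz
      refine .of_forall fun y => ?_
      simp only [Function.uncurry]
      rw [norm_mul, norm_mul, Real.norm_of_nonneg (heatKernel_nonneg _ _ _),
        Real.norm_of_nonneg (heatKernel_nonneg _ _ _), ← mul_assoc]
      exact mul_le_mul_of_nonneg_right (heatKernel_sub_le hθ ht hz.le y) (norm_nonneg _)
    · exact (((continuous_heatKernel θ t).comp (by fun_prop)).mul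
        continuous_const).continuousAt
  · simp only [intervalIntegral.intervalIntegral_eq_integral_uIoc]
    have h1 := coeFn_integral_Lp_ae_eq (μ := volume.restrict (Set.uIoc 0 x))
      hZm.aestronglyMeasurable
      (intervalIntegrable_iff.1 ((hW.continuous_heatDefect hθ ht).intervalIntegrable 0 x))
      (.of_forall hZ)
    filter_upwards [h1, Lp.coeFn_smul (if (0 : ℝ) ≤ x then (1 : ℝ) else -1)
      (∫ z in Set.uIoc 0 x, hW.heatDefect θ t z)] with ω h1 h2
    rw [h2, Pi.smul_apply, h1]

/-- Almost surely, the mild solution is continuously differentiable in space with derivative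
`σ / θ` times the continuous version of `heatDefect`. -/
lemma IsMildSolution.exists_hasDerivAt (hW : IsTwoSidedBrownian W P) {σ : ℝ} (hθ : 0 < θ)
    {u : ℝ → ℝ → Ω → ℝ} (hu : IsMildSolution σ θ W P u) (ht : 0 < t)
    (hcont : ∀ᵐ ω ∂P, Continuous fun x => u t x ω) :
    ∃ Z : ℝ → Ω → ℝ, (∀ x, Z x =ᵐ[P] hW.heatDefect θ t x) ∧
      ∀ᵐ ω ∂P, ∀ x, HasDerivAt (fun z => u t z ω) (σ / θ * Z x ω) x := by
  obtain ⟨Z, hZc, hZ, hZint⟩ := hW.exists_heatDefect_version hθ ht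
  refine ⟨Z, hZ, ?_⟩
  have hinc : ∀ x, ∀ᵐ ω ∂P, u t x ω = u t 0 ω + σ / θ * ∫ z in (0 : ℝ)..x, Z z ω := fun x => by
    have h := mildField_sub_eq hW σ hθ ht x
    filter_upwards [hu t ht.le x, hu t ht.le 0, hZint x,
      Lp.coeFn_sub (mildField σ θ W P t x) (mildField σ θ W P t 0),
      Lp.coeFn_smul (σ / θ) (∫ z in (0 : ℝ)..x, hW.heatDefect θ t z)] with ω h1 h2 h3 h4 h5
    rw [h, h5] at h4
    simp only [Pi.smul_apply, Pi.sub_apply, smul_eq_mul] at h4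
    rw [h1, h2, h3, h4]
    ring
  filter_upwards [hcont, hZc, ae_all_iff.2 fun q : ℚ => hinc q] with ω huc hZω hq x
  have hI : Continuous fun x => ∫ z in (0 : ℝ)..x, Z z ω :=
    intervalIntegral.continuous_primitive (fun a b => hZω.intervalIntegrable a b) 0
  have heq : (fun x => u t x ω) = fun x => u t 0 ω + σ / θ * ∫ z in (0 : ℝ)..x, Z z ω :=
    Rat.denseRange_cast.equalizer huc (continuous_const.add (continuous_const.mul hI))
      (funext fun q => hq q)
  rw [heq]
  exact ((intervalIntegral.integral_hasDerivAt_right (hZω.intervalIntegrable 0 x)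
    (hZω.stronglyMeasurableAtFilter _ _) hZω.continuousAt).const_mul _).const_add _

end Increments

/-! ### The limit theorem -/

lemma tendsto_rpow_mul_of_abs_le_div {f : ℕ → ℝ} {C : ℝ} (hf : ∀ N : ℕ, N ≠ 0 → |f N| ≤ C / N)
    {α : ℝ} (hα : α < 1) : Tendsto (fun N : ℕ => (N : ℝ) ^ α * f N) atTop (𝓝 0) := by
  have h1 : Tendsto (fun N : ℕ => C * (N : ℝ) ^ (-(1 - α))) atTop (𝓝 0) := by
    simpa using ((tendsto_rpow_neg_atTop (sub_pos.2 hα)).comp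
      tendsto_natCast_atTop_atTop).const_mul C
  refine squeeze_zero_norm' ?_ h1
  filter_upwards [eventually_ne_atTop 0] with N hN
  have hN' : (0 : ℝ) < N := by positivity
  rw [norm_mul, Real.norm_of_nonneg (by positivity), Real.norm_eq_abs, neg_sub,
    Real.rpow_sub_one hN'.ne']
  calc (N : ℝ) ^ α * |f N| ≤ (N : ℝ) ^ α * (C / N) := by gcongr; exact hf N hN
    _ = _ := by ring

theorem proposition3p2 {Ω : Type*} [MeasurableSpace Ω] (P : Measure Ω) [IsProbabilityMeasure P]
    (W : ℝ → Ω → ℝ) (hW : IsTwoSidedBrownian W P)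
    (θ σ : ℝ) (hθ : 0 < θ)
    (u : ℝ → ℝ → Ω → ℝ) (hu : IsMildSolution σ θ W P u)
    (hcont : ∀ t, 0 < t → ∀ᵐ ω ∂P, Continuous fun x => u t x ω)
    (A B : ℝ) (hAB : A < B) (t : ℝ) (ht : 0 < t) :
    (∀ᵐ ω ∂P, Differentiable ℝ fun x => u t x ω) ∧
    ∀ x : ℝ,
      MemLp (spatialDeriv u t x) 2 P ∧
      (∀ α : ℝ, α < 1 →
        Tendsto (fun N : ℕ => (N : ℝ) ^ α *
            ((N : ℝ) * ∫ ω, |spatialDeriv u t (x + (B - A) / N) ω - spatialDeriv u t x ω| ^ 2 ∂P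
              - σ ^ 2 * (B - A) / θ ^ 2)) atTop (𝓝 0)) ∧
      Tendsto (fun N : ℕ =>
            (N : ℝ) * ∫ ω, |spatialDeriv u t (x + (B - A) / N) ω - spatialDeriv u t x ω| ^ 2 ∂P)
          atTop (𝓝 (σ ^ 2 * (B - A) / θ ^ 2)) := by
  obtain ⟨Z, hZ, hder⟩ := hu.exists_hasDerivAt hW hθ ht (hcont t ht)
  have hux : ∀ x, spatialDeriv u t x =ᵐ[P] ((σ / θ) • hW.heatDefect θ t x : Lp ℝ 2 P) :=
    fun x => by
      filter_upwards [hder, hZ x, Lp.coeFn_smul (σ / θ) (hW.heatDefect θ t x)] with ω h1 h2 h3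
      rw [spatialDeriv, (h1 x).deriv, h3, Pi.smul_apply, h2, smul_eq_mul]
  have hE : ∀ x y, ∫ ω, |spatialDeriv u t y ω - spatialDeriv u t x ω| ^ 2 ∂P
      = (σ / θ) ^ 2 * ‖hW.heatDefect θ t y - hW.heatDefect θ t x‖ ^ 2 := fun x y => by
    rw [← sq_abs (σ / θ), ← Real.norm_eq_abs, ← mul_pow, ← norm_smul, smul_sub,
      ← real_inner_self_eq_norm_sq, L2.inner_def]
    refine integral_congr_ae ?_
    filter_upwards [hux x, hux y, Lp.coeFn_sub ((σ / θ) • hW.heatDefect θ t y)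
      ((σ / θ) • hW.heatDefect θ t x)] with ω h1 h2 h3
    rw [h3, Pi.sub_apply, h1, h2, real_inner_self_eq_norm_sq, Real.norm_eq_abs]
  refine ⟨hder.mono fun ω h x => (h x).differentiableAt, fun x => ?_⟩
  have hbound : ∀ N : ℕ, N ≠ 0 →
      |(N : ℝ) * ∫ ω, |spatialDeriv u t (x + (B - A) / N) ω - spatialDeriv u t x ω| ^ 2 ∂P
        - σ ^ 2 * (B - A) / θ ^ 2|
      ≤ ((σ / θ) ^ 2 * (4 * (√(4 * Real.pi * θ * t))⁻¹ * (B - A) ^ 2)) / N := fun N hN => by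
    have hN' : (0 : ℝ) < N := by positivity
    have h1 := hW.abs_norm_sq_heatDefect_sub_le hθ ht x
      (div_nonneg (sub_nonneg.2 hAB.le) hN'.le : 0 ≤ (B - A) / N)
    rw [hE]
    set n := ‖hW.heatDefect θ t (x + (B - A) / N) - hW.heatDefect θ t x‖ ^ 2
    have h2 : (N : ℝ) * ((σ / θ) ^ 2 * n) - σ ^ 2 * (B - A) / θ ^ 2
        = (N * (σ / θ) ^ 2) * (n - (B - A) / N) := by
      field_simp
    rw [h2, abs_mul, abs_of_nonneg (by positivity : 0 ≤ (N : ℝ) * (σ / θ) ^ 2)]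
    refine (mul_le_mul_of_nonneg_left h1 (by positivity)).trans (le_of_eq ?_)
    field_simp
  have hlim := fun α (hα : α < 1) => tendsto_rpow_mul_of_abs_le_div hbound hα
  refine ⟨(memLp_congr_ae (hux x)).2 (Lp.memLp _), hlim, ?_⟩
  have h0 := hlim 0 zero_lt_one
  simp only [Real.rpow_zero, one_mul] at h0
  have h1 := h0.add_const (σ ^ 2 * (B - A) / θ ^ 2)
  rw [zero_add] at h1
  exact h1.congr fun N => sub_add_cancel _ _
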